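/- A directed graph $E=(E^0,E^1,r,s)$ here has countable sets $E^0$ of vertices and $E^1$ of edges, with range and source maps $r,s\colon E^1\to E^0$. A path of length $n\ge 1$ is a sequence $\mu=e_1\cdots e_n$ of edges with $r(e_i)=s(e_{i+1})$, with $s(\mu)=s(e_1)$, $r(\mu)=r(e_n)$; the vertices are the paths of length $0$, with $s(v)=r(v)=v$; infinite paths $e_1e_2\cdots$ are defined likewise. $E$ satisfies Condition (L) if every cycle has an exit, i.e. for every path $e_1\cdots e_n$ with $n\ge1$ and $s(e_1)=r(e_n)$ there are $k$ and an edge $f\ne e_k$ with $s(f)=s(e_k)$. The boundary path space $\partial E$ consists of all infinite paths and of all finite paths $\mu$ such that $r(\mu)$ emits no edge or infinitely many edges. Its topology is generated by the sets $\mathcal Z(\mu)\setminus\bigcup_{e\in A}\mathcal Z(\mu e)$, where $\mu$ is a finite path, $A$ is a finite set of edges with source $r(\mu)$, and $\mathcal Z(\mu)$ is the set of elements of $\partial E$ with initial segment $\mu$. Let $|x|\in\{0,1,2,\dots,\infty\}$ be the length of $x$, let $\partial E^{\ge n}=\{x\in\partial E: |x|\ge n\}$, let $\sigma_E\colon\partial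 E^{\ge1}\to\partial E$ be the shift, which removes the first edge (and sends a path $e$ of length one to $r(e)$), and let $\sigma_E^n\colon\partial E^{\ge n}\to\partial E$ be its $n$-fold composition. The graph groupoid is $$\mathcal G_E=\{(x,m-n,y): x\in\partial E^{\ge m},\ y\in\partial E^{\ge n},\ m,n\in\mathbb N_0,\ \sigma_E^m(x)=\sigma_E^n(y)\},$$ with product $(x,k,y)(y,l,z)=(x,k+l,z)$, inverse $(x,k,y)^{-1}=(y,-k,x)$, and the topology generated by the sets $\{(x,m-n,y): x\in U,\ y\in V,\ \sigma_E^m(x)=\sigma_E^n(y)\}$, where $U\subseteq\partial E^{\ge m}$ and $V\subseteq\partial E^{\ge n}$ are open, $\sigma_E^m|_U$ and $\sigma_E^n|_V$ are injective, and $\sigma_E^m(U)=\sigma_E^n(V)$. The point $x\in\partial E$ is identified with the unit $(x,0,x)$. A homeomorphism $\kappa\colon\partial E\to\partial F$ is an orbit equivalence if there are continuous functions $l,m\colon\partial E^{\ge1}\to\mathbb N_0$ and $l',m'\colon\partial F^{\ge1}\to\mathbb N_0$ such that $\sigma_F^{m(x)}(\kappa(\sigma_E(x)))=\sigma_F^{l(x)}(\kappa(x))$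 for all $x\in\partial E^{\ge1}$ and $\sigma_E^{m'(y)}(\kappa^{-1}(\sigma_F(y)))=\sigma_E^{l'(y)}(\kappa^{-1}(y))$ for all $y\in\partial F^{\ge1}$ (in particular, all these expressions are defined). **Theorem.** Let $E$ and $F$ be directed graphs (with countably many vertices and edges) satisfying Condition (L), and let $\kappa\colon\partial E\to\partial F$ be an orbit equivalence. Then there is an isomorphism of topological groupoids (a groupoid isomorphism that is also a homeomorphism) $\phi\colon\mathcal G_E\to\mathcal G_F$ with $\phi(x,0,x)=(\kappa(x),0,\kappa(x))$ for all $x\in\partial E$. -/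

import Mathlib

/-- A directed graph with vertex set `V`, edge set `E`, source map `s` and range map `r`;
multiple edges and loops are allowed. -/
structure DirGraph (V : Type*) (E : Type*) where
  s : E → V
  r : E → V

namespace DirGraph

variable {V E : Type*}

/-- `G.IsPathFrom v [e₁, …, eₙ]`: the edges satisfy `s e₁ = v` and `r eᵢ = s eᵢ₊₁`. -/
def IsPathFrom (G : DirGraph V E) : V → List E → Prop
  | _, [] => True
  | v, e :: l => G.s e = v ∧ G.IsPathFrom (G.r e) l

/-- The vertex reached from `v` after the edges of the list. -/
def rangeFrom (G : DirGraph V E) : V → List E → V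
  | v, [] => v
  | _, e :: l => G.rangeFrom (G.r e) l

/-- A finite path, given by its source and its edges; the paths without edges are the vertices. -/
structure Path (G : DirGraph V E) where
  source : V
  edges : List E
  isPath : G.IsPathFrom source edges

/-- The range of a finite path. -/
def Path.range {G : DirGraph V E} (μ : G.Path) : V := G.rangeFrom μ.source μ.edges

/-- A cycle: a path of length at least one whose source and range agree. -/
def Path.IsCycle {G : DirGraph V E} (μ : G.Path) : Prop :=
  1 ≤ μ.edges.length ∧ μ.source = μ.range

/-- Some edge `f` starts where an edge `e` of `μ` starts, but differs from `e`. -/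
def Path.HasExit {G : DirGraph V E} (μ : G.Path) : Prop :=
  ∃ e ∈ μ.edges, ∃ f : E, G.s f = G.s e ∧ f ≠ e

/-- Condition (L): every cycle has an exit. -/
def ConditionL (G : DirGraph V E) : Prop :=
  ∀ μ : G.Path, μ.IsCycle → μ.HasExit

/-- A regular vertex emits at least one and only finitely many edges. -/
def IsRegular (G : DirGraph V E) (v : V) : Prop :=
  {e : E | G.s e = v}.Nonempty ∧ {e : E | G.s e = v}.Finite

/-- A singular vertex is a sink or an infinite emitter. -/
def IsSingular (G : DirGraph V E) (v : V) : Prop := ¬ G.IsRegular v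

theorem isPathFrom_append (G : DirGraph V E) {e : E} :
    ∀ (v : V) (l : List E), G.IsPathFrom v l → G.s e = G.rangeFrom v l →
      G.IsPathFrom v (l ++ [e])
  | _, [], _, h => ⟨h, trivial⟩
  | _, _ :: l, hl, h => ⟨hl.1, G.isPathFrom_append _ l hl.2 h⟩

/-- The path `μe`, for an edge `e` that starts at the range of `μ`. -/
def Path.snoc {G : DirGraph V E} (μ : G.Path) (e : {e : E // G.s e = μ.range}) : G.Path where
  source := μ.source
  edges := μ.edges ++ [e.1]
  isPath := G.isPathFrom_append _ _ μ.isPath e.2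

/-- The boundary path space: infinite paths, and finite paths that end at a singular vertex. -/
inductive BoundaryPath (G : DirGraph V E)
  | infinite (e : ℕ → E) (h : ∀ i, G.r (e i) = G.s (e (i + 1))) : BoundaryPath G
  | finite (μ : G.Path) (h : G.IsSingular μ.range) : BoundaryPath G

namespace BoundaryPath

variable {G : DirGraph V E}

/-- The source of a boundary path. -/
def source : G.BoundaryPath → V
  | infinite e _ => G.s (e 0)
  | finite μ _ => μ.source

/-- The edge at position `i` (counted from `0`), if there is one. -/
def edge : G.BoundaryPath → ℕ → Option E
  | infinite e _, i => some (e i)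
  | finite μ _, i => μ.edges[i]?

/-- The length `|x|` of a boundary path. -/
def length : G.BoundaryPath → ℕ∞
  | infinite _ _ => ⊤
  | finite μ _ => (μ.edges.length : ℕ∞)

/-- The shift map `σ`, removing the first edge. It is meant for paths of length at least one;
as a total function it fixes the paths of length zero, and every use of `shift^[n] x` below comes
with the condition `n ≤ x.length`. -/
def shift : G.BoundaryPath → G.BoundaryPath
  | infinite e h => infinite (fun i => e (i + 1)) (fun i => h (i + 1))
  | finite ⟨v, [], p⟩ h => finite ⟨v, [], p⟩ h
  | finite ⟨_, e :: l, p⟩ h => finite ⟨G.r e, l, p.2⟩ h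

end BoundaryPath

/-- The cylinder set `Z(μ)` of all `μx ∈ ∂E`, that is, of the boundary paths with initial
segment `μ`: they have the source of `μ`, and their first edges are those of `μ`. -/
def cylinder {G : DirGraph V E} (μ : G.Path) : Set G.BoundaryPath :=
  {x | x.source = μ.source ∧ ∀ i < μ.edges.length, x.edge i = μ.edges[i]?}

/-- The set `Z(μ \ F) = Z(μ) \ ⋃ e ∈ F, Z(μe)`, for a finite set `F` of edges that start at the
range of `μ`. -/
def basicSet {G : DirGraph V E} (μ : G.Path) (F : Finset {e : E // G.s e = μ.range}) :
    Set G.BoundaryPath :=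
  cylinder μ \ ⋃ e ∈ F, cylinder (μ.snoc e)

instance (G : DirGraph V E) : TopologicalSpace G.BoundaryPath :=
  TopologicalSpace.generateFrom
    {Z | ∃ (μ : G.Path) (F : Finset {e : E // G.s e = μ.range}), Z = basicSet μ F}

namespace BoundaryPath

variable {G : DirGraph V E}

theorem length_shift {x : G.BoundaryPath} (hx : 1 ≤ x.length) :
    x.shift.length + 1 = x.length := by
  match x, hx with
  | infinite e h, _ => rfl
  | finite ⟨v, [], p⟩ h, hx => simp [length] at hx
  | finite ⟨v, e :: l, p⟩ h, _ => simp [length, shift]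

theorem length_iterate_shift (n : ℕ) : ∀ {x : G.BoundaryPath}, (n : ℕ∞) ≤ x.length →
    (shift^[n] x).length + n = x.length := by
  induction n with
  | zero => intro x _; simp
  | succ n ih =>
    intro x hx
    have h1 : 1 ≤ x.length := le_trans (by simp) hx
    have h2 := length_shift h1
    have h3 : (n : ℕ∞) ≤ x.shift.length := by
      rw [← h2] at hx
      push_cast at hx
      exact (ENat.add_le_add_iff_right ENat.one_ne_top).1 hx
    rw [Function.iterate_succ_apply, ← h2, ← ih h3]
    push_cast
    rw [add_assoc]

theorem add_le_length {m n d : ℕ} {x y : G.BoundaryPath} (hx : (m : ℕ∞) ≤ x.length)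
    (hy : (n : ℕ∞) ≤ y.length) (h : shift^[m] x = shift^[n] y)
    (hd : ((d + n : ℕ) : ℕ∞) ≤ y.length) : ((d + m : ℕ) : ℕ∞) ≤ x.length := by
  rw [← length_iterate_shift n hy, Nat.cast_add] at hd
  rw [← length_iterate_shift m hx, h, Nat.cast_add]
  gcongr
  exact (ENat.add_le_add_iff_right (ENat.natCast_ne_top n)).1 hd

end BoundaryPath

open BoundaryPath in
/-- The graph groupoid: all triples `(x, k, y)` with `k = m - n` for some `m ≤ |x|` and `n ≤ |y|`
such that `σ^m x = σ^n y`. Its range map is `(x, k, y) ↦ x` and its source map is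
`(x, k, y) ↦ y`. -/
@[ext]
structure GraphGroupoid (G : DirGraph V E) where
  range : G.BoundaryPath
  lag : ℤ
  source : G.BoundaryPath
  mem : ∃ m n : ℕ, lag = (m : ℤ) - (n : ℤ) ∧ (m : ℕ∞) ≤ range.length ∧
    (n : ℕ∞) ≤ source.length ∧ shift^[m] range = shift^[n] source

namespace GraphGroupoid

open BoundaryPath

variable {G : DirGraph V E}

/-- The product `(x, k, y) (y, l, z) = (x, k + l, z)`, defined when the source of the first
factor is the range of the second. -/
def mul (g h : G.GraphGroupoid) (hgh : g.source = h.range) : G.GraphGroupoid where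
  range := g.range
  lag := g.lag + h.lag
  source := h.source
  mem := by
    obtain ⟨m, n, hk, hm, hn, hs⟩ := g.mem
    obtain ⟨p, q, hl, hp, hq, ht⟩ := h.mem
    rw [← hgh] at hp ht
    rcases le_total n p with hnp | hpn
    · obtain ⟨d, rfl⟩ := Nat.exists_eq_add_of_le' hnp
      refine ⟨d + m, q, by push_cast at hl ⊢; omega, add_le_length hm hn hs hp, hq, ?_⟩
      rw [Function.iterate_add_apply, hs, ← Function.iterate_add_apply, ht]
    · obtain ⟨d, rfl⟩ := Nat.exists_eq_add_of_le' hpn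
      refine ⟨m, d + q, by push_cast at hk ⊢; omega, hm,
        add_le_length hq hp ht.symm hn, ?_⟩
      rw [Function.iterate_add_apply _ d q, ← ht, ← Function.iterate_add_apply, hs]

/-- The inverse `(x, k, y)⁻¹ = (y, -k, x)`. -/
def inv (g : G.GraphGroupoid) : G.GraphGroupoid where
  range := g.source
  lag := -g.lag
  source := g.range
  mem := by
    obtain ⟨m, n, hk, hm, hn, hs⟩ := g.mem
    exact ⟨n, m, by omega, hn, hm, hs.symm⟩

/-- The unit `(x, 0, x)`, by which `x ∈ ∂E` is identified with an element of the unit space. -/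
def unit (x : G.BoundaryPath) : G.GraphGroupoid where
  range := x
  lag := 0
  source := x
  mem := ⟨0, 0, by simp, by simp, by simp, rfl⟩

/-- The set `Z(U, m, n, V)` of all `(x, m - n, y)` with `x ∈ U`, `y ∈ V` and `σ^m x = σ^n y`. -/
def basicSet (U : Set G.BoundaryPath) (m n : ℕ) (W : Set G.BoundaryPath) : Set G.GraphGroupoid :=
  {g | g.range ∈ U ∧ g.lag = (m : ℤ) - (n : ℤ) ∧ g.source ∈ W ∧
    shift^[m] g.range = shift^[n] g.source}

/-- The topology generated by the sets `Z(U, m, n, V)`, where `U` is an open set of paths of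
length at least `m` on which `σ^m` is injective, `V` is an open set of paths of length at least
`n` on which `σ^n` is injective, and `σ^m(U) = σ^n(V)`. -/
instance : TopologicalSpace G.GraphGroupoid :=
  TopologicalSpace.generateFrom
    {Z | ∃ (m n : ℕ) (U W : Set G.BoundaryPath),
      IsOpen U ∧ (∀ x ∈ U, (m : ℕ∞) ≤ x.length) ∧ Set.InjOn shift^[m] U ∧
      IsOpen W ∧ (∀ y ∈ W, (n : ℕ∞) ≤ y.length) ∧ Set.InjOn shift^[n] W ∧
      shift^[m] '' U = shift^[n] '' W ∧ Z = basicSet U m n W}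

/-- An isomorphism of topological groupoids between two graph groupoids: a homeomorphism under
which the composable pairs correspond to each other and which respects products and inverses. -/
structure Iso {V' E' : Type*} (G : DirGraph V E) (H : DirGraph V' E') where
  toHomeomorph : G.GraphGroupoid ≃ₜ H.GraphGroupoid
  composable_iff : ∀ g h : G.GraphGroupoid,
    g.source = h.range ↔ (toHomeomorph g).source = (toHomeomorph h).range
  map_mul : ∀ (g h : G.GraphGroupoid) (hgh : g.source = h.range),
    toHomeomorph (g.mul h hgh) =
      (toHomeomorph g).mul (toHomeomorph h) ((composable_iff g h).1 hgh)
  map_inv : ∀ g : G.GraphGroupoid, toHomeomorph g.inv = (toHomeomorph g).inv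

end GraphGroupoid

open BoundaryPath in
/-- There are continuous `l, m : ∂E^{≥1} → ℕ` with `σ^{m(x)}(κ(σ(x))) = σ^{l(x)}(κ(x))` for all
`x ∈ ∂E^{≥1}`; the first two inequalities say that both sides are defined. -/
def HasOrbitCocycles {V' E' : Type*} {G : DirGraph V E} {H : DirGraph V' E'}
    (κ : G.BoundaryPath → H.BoundaryPath) : Prop :=
  ∃ l m : {x : G.BoundaryPath // 1 ≤ x.length} → ℕ, Continuous l ∧ Continuous m ∧
    ∀ x : {x : G.BoundaryPath // 1 ≤ x.length},
      (m x : ℕ∞) ≤ (κ (shift x.1)).length ∧ (l x : ℕ∞) ≤ (κ x.1).length ∧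
      shift^[m x] (κ (shift x.1)) = shift^[l x] (κ x.1)

/-- An orbit equivalence: a homeomorphism `κ` of the boundary path spaces such that both `κ` and
its inverse intertwine the orbits of the shifts through continuous cocycles. -/
def IsOrbitEquivalence {V' E' : Type*} {G : DirGraph V E} {H : DirGraph V' E'}
    (κ : G.BoundaryPath ≃ₜ H.BoundaryPath) : Prop :=
  HasOrbitCocycles κ ∧ HasOrbitCocycles κ.symm

end DirGraph

/-!
The isomorphism is the one that `κ` induces on germs. An element `(x, m - n, y)` of the graph
groupoid stands for the germ at `(x, y)` of the relation `σ^m x' = σ^n y'`. Since `σ` is a local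
homeomorphism (`isLocalHomeomorphOn_iterate_shift`), this germ depends only on the lag `m - n`
(`ShiftRel.eventually_imp`), and it is the graph of a homeomorphism from a neighbourhood of `x` to
one of `y` (a section is given by `ShiftRel.exists_section`).

The cocycles of an orbit equivalence, being locally constant, say that `κ` carries the germ of the
shift at `x`, where `m - n = 1`, to the germ of a relation `σ^a (κ x') = σ^b (κ y')`. Such a
transport of germs (`MapsGerm`) is compatible with products and inverses, and the iterated shifts
and their inverses generate the groupoid; hence `κ` carries the germ of every groupoid element
`(x, k, y)` to the germ of some `(κ x, k', κ y)`.

Condition (L) makes `k'` unique (`MapsGerm.unique`): two values would make all paths in an open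
set eventually periodic with a common period, whereas a path that runs around a cycle is
approximated by paths that leave the cycle at an exit
(`not_eventually_shiftRel_of_lt`). Uniqueness shows that `(x, k, y) ↦ (κ x, k', κ y)` is a
homomorphism, that it is continuous, because the germ at nearby elements is carried by the same
exponents, and that the map obtained in the same way from `κ⁻¹` is its inverse.
-/

open Filter Topology

namespace DirGraph

variable {V E V' E' : Type*} {G : DirGraph V E} {H : DirGraph V' E'}

theorem isPathFrom_of_append {e : E} : ∀ {v : V} {l : List E}, G.IsPathFrom v (l ++ [e]) →
    G.IsPathFrom v l ∧ G.s e = G.rangeFrom v l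
  | _, [], h => ⟨trivial, h.1⟩
  | _, _ :: _, h => ⟨⟨h.1, (isPathFrom_of_append h.2).1⟩, (isPathFrom_of_append h.2).2⟩

namespace BoundaryPath

/-! ### Edges and shifts of boundary paths -/

theorem ext_edge {x y : G.BoundaryPath} (h : x.source = y.source)
    (he : ∀ i, x.edge i = y.edge i) : x = y := by
  match x, y with
  | infinite e h, infinite f h' =>
    obtain rfl : e = f := funext fun i => by simpa [edge] using he i
    rfl
  | infinite e h, finite μ h' =>
    have := he μ.edges.length
    simp [edge] at this
  | finite μ h', infinite e h =>
    have := he μ.edges.length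
    simp [edge] at this
  | finite ⟨v, l, p⟩ hl, finite ⟨w, k, q⟩ hk =>
    obtain rfl : v = w := h
    obtain rfl : l = k := List.ext_getElem? he
    rfl

theorem edge_shift (x : G.BoundaryPath) (i : ℕ) : x.shift.edge i = x.edge (i + 1) := by
  match x with
  | infinite e h => rfl
  | finite ⟨v, [], p⟩ h => simp [edge, shift]
  | finite ⟨v, e :: l, p⟩ h => simp [edge, shift]

theorem edge_iterate_shift (n i : ℕ) (x : G.BoundaryPath) :
    (shift^[n] x).edge i = x.edge (i + n) := by
  induction n generalizing i with
  | zero => rfl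
  | succ n ih => rw [Function.iterate_succ_apply', edge_shift, ih]; congr 1; omega

theorem source_eq_of_edge {x : G.BoundaryPath} {e : E} (h : x.edge 0 = some e) :
    x.source = G.s e := by
  match x with
  | infinite f h' => obtain rfl : f 0 = e := by simpa [edge] using h
                     rfl
  | finite ⟨v, [], p⟩ h' => simp [edge] at h
  | finite ⟨v, f :: l, p⟩ h' =>
    obtain rfl : f = e := by simpa [edge] using h
    exact p.1.symm

theorem source_shift {x : G.BoundaryPath} {e : E} (h : x.edge 0 = some e) :
    x.shift.source = G.r e := by
  match x with
  | infinite f h' =>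
    obtain rfl : f 0 = e := by simpa [edge] using h
    exact (h' 0).symm
  | finite ⟨v, [], p⟩ h' => simp [edge] at h
  | finite ⟨v, f :: l, p⟩ h' =>
    obtain rfl : f = e := by simpa [edge] using h
    rfl

theorem exists_edge_iff {x : G.BoundaryPath} : (∃ e, x.edge 0 = some e) ↔ 1 ≤ x.length := by
  match x with
  | infinite f h' => simp [edge, length]
  | finite ⟨v, [], p⟩ h' => simp [edge, length]
  | finite ⟨v, f :: l, p⟩ h' => simp [edge, length]

theorem eq_of_edge_of_shift {x y : G.BoundaryPath} {e : E} (hx : x.edge 0 = some e)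
    (hy : y.edge 0 = some e) (h : x.shift = y.shift) : x = y := by
  refine ext_edge ((source_eq_of_edge hx).trans (source_eq_of_edge hy).symm) fun i => ?_
  cases i with
  | zero => rw [hx, hy]
  | succ i => rw [← edge_shift, h, edge_shift]

/-- The boundary path `ex` exists when `e` ends where `x` starts. -/
theorem exists_cons {e : E} {x : G.BoundaryPath} (h : x.source = G.r e) :
    ∃ y : G.BoundaryPath, y.edge 0 = some e ∧ y.shift = x := by
  match x with
  | infinite f h' =>
    refine ⟨infinite (fun i => Nat.casesOn i e f) fun i => ?_, rfl, rfl⟩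
    cases i with
    | zero => exact h.symm
    | succ i => exact h' i
  | finite ⟨v, l, p⟩ h' =>
    obtain rfl : v = G.r e := h
    exact ⟨finite ⟨G.s e, e :: l, ⟨rfl, p⟩⟩ h', rfl, rfl⟩

theorem le_length_shift {n : ℕ} {x : G.BoundaryPath} (hx : ((n + 1 : ℕ) : ℕ∞) ≤ x.length) :
    (n : ℕ∞) ≤ x.shift.length := by
  rw [← length_shift (le_trans (by simp) hx)] at hx
  push_cast at hx
  exact (ENat.add_le_add_iff_right ENat.one_ne_top).1 hx

/-- The boundary path `μz`, where `μ` consists of the first `n` edges of `x`. -/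
theorem exists_replace_tail (n : ℕ) : ∀ {x z : G.BoundaryPath}, (n : ℕ∞) ≤ x.length →
    z.source = (shift^[n] x).source →
    ∃ y : G.BoundaryPath, shift^[n] y = z ∧ y.source = x.source ∧
      ∀ i < n, y.edge i = x.edge i := by
  induction n with
  | zero => intro x z _ hz; exact ⟨z, rfl, hz, by simp⟩
  | succ n ih =>
    intro x z hx hz
    have h1 : 1 ≤ x.length := le_trans (by simp) hx
    obtain ⟨e, he⟩ := exists_edge_iff.2 h1
    obtain ⟨y, hy, hys, hye⟩ := ih (le_length_shift hx) hz
    obtain ⟨w, hw, rfl⟩ := exists_cons (hys.trans (source_shift he))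
    refine ⟨w, hy, (source_eq_of_edge hw).trans (source_eq_of_edge he).symm, fun i hi => ?_⟩
    cases i with
    | zero => rw [hw, he]
    | succ i => rw [← edge_shift, ← edge_shift]; exact hye i (by omega)

/-- Every vertex is the source of a boundary path: either some path from `v` ends at a singular
vertex, or a path from `v` can be continued for ever. -/
theorem exists_source_eq (v : V) : ∃ x : G.BoundaryPath, x.source = v := by
  by_cases hv : ∃ l, G.IsPathFrom v l ∧ G.IsSingular (G.rangeFrom v l)
  · obtain ⟨l, hl, hs⟩ := hv
    exact ⟨finite ⟨v, l, hl⟩ hs, rfl⟩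
  let S : Set V := {u | ∀ l, G.IsPathFrom u l → G.IsRegular (G.rangeFrom u l)}
  have hvS : v ∈ S := fun l hl => by
    by_contra h
    exact hv ⟨l, hl, h⟩
  have hemit : ∀ u : S, ∃ e : E, G.s e = u := fun u => (u.2 [] trivial).1
  choose f hf using hemit
  let next : S → S := fun u => ⟨G.r (f u), fun l hl => u.2 (f u :: l) ⟨hf u, hl⟩⟩
  refine ⟨infinite (fun i => f (next^[i] ⟨v, hvS⟩)) fun i => ?_, hf _⟩
  rw [hf, Function.iterate_succ_apply']

/-! ### The topology of the boundary path space -/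

/-- The cylinder set of the boundary paths that start at `v` and whose first edges are those of
`l`. The list `l` need not form a path from `v`; if it does not, the set is empty. -/
def cyl (G : DirGraph V E) (v : V) (l : List E) : Set G.BoundaryPath :=
  {x | x.source = v ∧ ∀ i < l.length, x.edge i = l[i]?}

theorem mem_cyl_nil {x : G.BoundaryPath} {v : V} : x ∈ cyl G v [] ↔ x.source = v := by
  simp [cyl]

theorem mem_cyl_cons {x : G.BoundaryPath} {v : V} {e : E} {l : List E} :
    x ∈ cyl G v (e :: l) ↔ v = G.s e ∧ x.edge 0 = some e ∧ x.shift ∈ cyl G (G.r e) l := by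
  constructor
  · rintro ⟨hv, h⟩
    have h0 : x.edge 0 = some e := by simpa using h 0 (by simp)
    refine ⟨hv.symm.trans (source_eq_of_edge h0), h0, source_shift h0, fun i hi => ?_⟩
    rw [edge_shift]
    simpa using h (i + 1) (by simpa using hi)
  · rintro ⟨hv, h0, -, h⟩
    refine ⟨(source_eq_of_edge h0).trans hv.symm, fun i hi => ?_⟩
    cases i with
    | zero => simpa using h0
    | succ i => rw [← edge_shift, h i (by simpa using hi)]; simp

theorem isPathFrom_of_mem_cyl : ∀ {l : List E} {v : V} {x : G.BoundaryPath},
    x ∈ cyl G v l → G.IsPathFrom v l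
  | [], _, _, _ => trivial
  | _ :: _, _, _, h =>
    ⟨(mem_cyl_cons.1 h).1.symm, isPathFrom_of_mem_cyl (mem_cyl_cons.1 h).2.2⟩

theorem isOpen_basicSet (μ : G.Path) (F : Finset {e : E // G.s e = μ.range}) :
    IsOpen (basicSet μ F) :=
  TopologicalSpace.isOpen_generateFrom_of_mem ⟨μ, F, rfl⟩

theorem isOpen_cyl (v : V) (l : List E) : IsOpen (cyl G v l) := by
  by_cases hl : G.IsPathFrom v l
  · have : cyl G v l = basicSet ⟨v, l, hl⟩ ∅ := by
      simp [basicSet, cylinder, cyl]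
    exact this ▸ isOpen_basicSet _ _
  · have : cyl G v l = ∅ :=
      Set.eq_empty_of_forall_notMem fun x hx => hl (isPathFrom_of_mem_cyl hx)
    exact this ▸ isOpen_empty

theorem cyl_append_subset (v : V) (l k : List E) : cyl G v (l ++ k) ⊆ cyl G v l :=
  fun x hx => ⟨hx.1, fun i hi => by
    rw [hx.2 i (by simp; omega), List.getElem?_append_left hi]⟩

theorem isClosed_cyl (v : V) (l : List E) : IsClosed (cyl G v l) := by
  induction l using List.reverseRecOn with
  | nil =>
    have : (cyl G v [])ᶜ = ⋃ w ∈ ({v}ᶜ : Set V), cyl G w [] := by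
      ext x
      simp [mem_cyl_nil]
    rw [← isOpen_compl_iff, this]
    exact isOpen_biUnion fun w _ => isOpen_cyl w []
  | append_singleton l e ih =>
    by_cases hl : G.IsPathFrom v (l ++ [e])
    · obtain ⟨h1, h2⟩ := isPathFrom_of_append hl
      have : (cyl G v (l ++ [e]))ᶜ = (cyl G v l)ᶜ ∪ basicSet ⟨v, l, h1⟩ {⟨e, h2⟩} := by
        have h3 : basicSet ⟨v, l, h1⟩ {⟨e, h2⟩} = cyl G v l \ cyl G v (l ++ [e]) := by
          simp [basicSet, cylinder, cyl, Path.snoc]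
        rw [h3]
        ext x
        have := @cyl_append_subset _ _ G v l [e] x
        simp only [Set.mem_compl_iff, Set.mem_union, Set.mem_sdiff]
        tauto
      rw [← isOpen_compl_iff, this]
      exact ih.isOpen_compl.union (isOpen_basicSet _ _)
    · have : cyl G v (l ++ [e]) = ∅ :=
        Set.eq_empty_of_forall_notMem fun x hx => hl (isPathFrom_of_mem_cyl hx)
      exact this ▸ isClosed_empty

theorem eventually_mem_cyl_iff (x : G.BoundaryPath) (v : V) (l : List E) :
    ∀ᶠ y in 𝓝 x, (y ∈ cyl G v l ↔ x ∈ cyl G v l) := by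
  by_cases hx : x ∈ cyl G v l
  · filter_upwards [(isOpen_cyl v l).mem_nhds hx] with y hy
    simp [hx, hy]
  · filter_upwards [(isClosed_cyl v l).isOpen_compl.mem_nhds hx] with y hy
    exact iff_of_false hy hx

/-- Convergence in the boundary path space is tested on the cylinder sets. -/
theorem tendsto_nhds_of_cyl {X : Type*} {f : X → G.BoundaryPath} {F : Filter X}
    {x : G.BoundaryPath} (h : ∀ v l, ∀ᶠ t in F, (f t ∈ cyl G v l ↔ x ∈ cyl G v l)) :
    Tendsto f F (𝓝 x) := by
  refine TopologicalSpace.tendsto_nhds_generateFrom_iff.2 ?_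
  rintro _ ⟨μ, A, rfl⟩ ⟨hx, hxA⟩
  have h1 : ∀ᶠ t in F, ∀ e ∈ A, (f t ∈ cylinder (μ.snoc e) ↔ x ∈ cylinder (μ.snoc e)) :=
    (Finset.eventually_all A).2 fun e _ => h _ _
  filter_upwards [h μ.source μ.edges, h1] with t ht htA
  refine ⟨ht.2 hx, fun hA => hxA ?_⟩
  simp only [Set.mem_iUnion] at hA ⊢
  obtain ⟨e, heA, he⟩ := hA
  exact ⟨e, heA, (htA e heA).1 he⟩

/-- A neighbourhood of `x` contains all paths that agree with `x` for long enough. -/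
theorem exists_agree {x : G.BoundaryPath} {p : G.BoundaryPath → Prop} (hp : ∀ᶠ y in 𝓝 x, p y) :
    ∃ N : ℕ, ∀ y : G.BoundaryPath, y.source = x.source → (∀ i < N, y.edge i = x.edge i) → p y := by
  by_contra! hN
  choose y hs he hy using hN
  have : Tendsto y atTop (𝓝 x) := tendsto_nhds_of_cyl fun v l => by
    filter_upwards [eventually_ge_atTop l.length] with N hN
    refine and_congr (by rw [hs]) (forall₂_congr fun i hi => ?_)
    rw [he N i (lt_of_lt_of_le hi hN)]
  obtain ⟨N, hN⟩ := (this.eventually hp).exists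
  exact hy N hN

/-! ### The shift is a local homeomorphism -/

theorem edge_zero_iff {x : G.BoundaryPath} {e : E} :
    x.edge 0 = some e ↔ x ∈ cyl G (G.s e) [e] := by
  rw [mem_cyl_cons, mem_cyl_nil]
  exact ⟨fun h => ⟨rfl, h, source_shift h⟩, fun h => h.2.1⟩

theorem isLocalHomeomorphOn_shift :
    IsLocalHomeomorphOn (shift : G.BoundaryPath → G.BoundaryPath) {x | 1 ≤ x.length} := by
  intro x hx
  obtain ⟨e, he⟩ := exists_edge_iff.2 hx
  have hS : {y : G.BoundaryPath | y.edge 0 = some e} = cyl G (G.s e) [e] :=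
    Set.ext fun y => edge_zero_iff
  have hbij : Set.BijOn shift {y : G.BoundaryPath | y.edge 0 = some e} (cyl G (G.r e) []) :=
    ⟨fun y hy => mem_cyl_nil.2 (source_shift hy),
      fun y hy z hz h => eq_of_edge_of_shift hy hz h,
      fun y hy => exists_cons (mem_cyl_nil.1 hy)⟩
  have : Nonempty G.BoundaryPath := ⟨x⟩
  have hinv : ∀ z ∈ cyl G (G.r e) [], (Function.invFunOn shift {y | y.edge 0 = some e} z).edge 0
      = some e := fun z hz => hbij.surjOn.mapsTo_invFunOn hz
  have hsh : ∀ z ∈ cyl G (G.r e) [], shift (Function.invFunOn shift {y | y.edge 0 = some e} z)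
      = z := fun z hz => hbij.invOn_invFunOn.2 hz
  refine ⟨{ hbij.toPartialEquiv with
    open_source := by
      change IsOpen {y : G.BoundaryPath | y.edge 0 = some e}
      exact hS ▸ isOpen_cyl _ _
    open_target := isOpen_cyl _ _
    continuousOn_toFun := fun y hy => ?_
    continuousOn_invFun := fun z hz => ?_ }, he, rfl⟩
  · change y.edge 0 = some e at hy
    refine Tendsto.mono_left (tendsto_nhds_of_cyl fun v l => ?_) nhdsWithin_le_nhds
    filter_upwards [eventually_mem_cyl_iff y (G.s e) (e :: l),
      (isOpen_cyl _ _).mem_nhds (edge_zero_iff.1 hy)] with y' h1 h2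
    rw [← edge_zero_iff] at h2
    simp only [mem_cyl_cons, hy, h2, true_and] at h1
    by_cases hv : v = G.r e
    · rw [hv]; exact h1
    · exact iff_of_false (fun h => hv (h.1.symm.trans (source_shift h2)))
        fun h => hv (h.1.symm.trans (source_shift hy))
  · change z ∈ cyl G (G.r e) [] at hz
    refine Tendsto.mono_left (tendsto_nhds_of_cyl fun v l => ?_) nhdsWithin_le_nhds
    cases l with
    | nil =>
      filter_upwards [(isOpen_cyl _ _).mem_nhds hz] with z' hz'
      change Function.invFunOn _ _ z' ∈ _ ↔ Function.invFunOn _ _ z ∈ _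
      rw [mem_cyl_nil, mem_cyl_nil, source_eq_of_edge (hinv z' hz'),
        source_eq_of_edge (hinv z hz)]
    | cons f l =>
      filter_upwards [(isOpen_cyl _ _).mem_nhds hz, eventually_mem_cyl_iff z (G.r f) l]
        with z' hz' h1
      change Function.invFunOn _ _ z' ∈ _ ↔ Function.invFunOn _ _ z ∈ _
      rw [mem_cyl_cons, mem_cyl_cons, hinv z' hz', hinv z hz, hsh z' hz', hsh z hz, h1]

theorem isLocalHomeomorphOn_iterate_shift (n : ℕ) :
    IsLocalHomeomorphOn (shift^[n] : G.BoundaryPath → G.BoundaryPath)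
      {x | (n : ℕ∞) ≤ x.length} := by
  induction n with
  | zero => exact fun x _ => ⟨OpenPartialHomeomorph.refl _, trivial, rfl⟩
  | succ n ih =>
    rw [Function.iterate_succ]
    refine ih.comp (isLocalHomeomorphOn_shift.mono fun x hx => ?_)
      fun x hx => le_length_shift hx
    have hx' : ((n + 1 : ℕ) : ℕ∞) ≤ x.length := hx
    exact le_trans (by simp) hx'

theorem eventually_le_length {x : G.BoundaryPath} : ∀ {n : ℕ}, (n : ℕ∞) ≤ x.length →
    ∀ᶠ y in 𝓝 x, (n : ℕ∞) ≤ y.length := by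
  intro n
  induction n generalizing x with
  | zero => simp
  | succ n ih =>
    intro hx
    have h1 : 1 ≤ x.length := le_trans (by simp) hx
    obtain ⟨e, he⟩ := exists_edge_iff.2 h1
    have hc : ContinuousAt shift x := isLocalHomeomorphOn_shift.continuousAt h1
    filter_upwards [hc.eventually (ih (le_length_shift hx)),
      (isOpen_cyl _ _).mem_nhds (edge_zero_iff.1 he)] with y hy hy1
    rw [← length_shift (exists_edge_iff.1 ⟨e, edge_zero_iff.2 hy1⟩)]
    push_cast
    gcongr

theorem continuousAt_iterate_shift {n : ℕ} {x : G.BoundaryPath} (hx : (n : ℕ∞) ≤ x.length) :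
    ContinuousAt shift^[n] x :=
  (isLocalHomeomorphOn_iterate_shift n).continuousAt hx

/-! ### Shift-tail relations and their local behaviour -/

/-- `σ^p x = σ^q y`, both sides being defined. The triples `(x, p - q, y)` with `ShiftRel p q x y`
are the elements of the graph groupoid. -/
structure ShiftRel (p q : ℕ) (x y : G.BoundaryPath) : Prop where
  le_left : (p : ℕ∞) ≤ x.length
  le_right : (q : ℕ∞) ≤ y.length
  eq : shift^[p] x = shift^[q] y

namespace ShiftRel

variable {m n m' n' p q : ℕ} {x y z : G.BoundaryPath}

theorem refl (x : G.BoundaryPath) : ShiftRel 0 0 x x := ⟨by simp, by simp, rfl⟩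

theorem symm (h : ShiftRel p q x y) : ShiftRel q p y x := ⟨h.le_right, h.le_left, h.eq.symm⟩

/-- The truncated differences compare `q` and `m`: whichever of the two relations shifts `y` by
less is shifted further until both shift `y` by `max q m`. -/
theorem trans (h : ShiftRel p q x y) (h' : ShiftRel m n y z) :
    ShiftRel (p + (m - q)) (n + (q - m)) x z := by
  obtain ⟨hp, hq, hs⟩ := h
  obtain ⟨hm, hn, ht⟩ := h'
  rcases le_total q m with hqm | hmq
  · obtain ⟨d, rfl⟩ := Nat.exists_eq_add_of_le' hqm
    have h1 : p + (d + q - q) = d + p := by omega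
    have h2 : n + (q - (d + q)) = n := by omega
    rw [h1, h2]
    refine ⟨add_le_length hp hq hs hm, hn, ?_⟩
    rw [Function.iterate_add_apply, hs, ← Function.iterate_add_apply, ht]
  · obtain ⟨d, rfl⟩ := Nat.exists_eq_add_of_le' hmq
    have h1 : p + (m - (d + m)) = p := by omega
    have h2 : n + (d + m - m) = d + n := by omega
    rw [h1, h2]
    refine ⟨hp, add_le_length hn hm ht.symm hq, ?_⟩
    rw [Function.iterate_add_apply _ d n, ← ht, ← Function.iterate_add_apply, hs]

/-- Two relations with the same lag that hold at `(x, y)` are equivalent near `(x, y)`: the one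
with smaller exponents implies the other after a further shift by some `d`, and is implied by
the other since `σ^d` is injective near the common tail. -/
theorem eventually_imp (h : ShiftRel m n x y) (h' : ShiftRel m' n' x y)
    (hk : (m : ℤ) - n = m' - n') :
    ∀ᶠ t in 𝓝 (x, y), ShiftRel m n t.1 t.2 → ShiftRel m' n' t.1 t.2 := by
  have hl1 : ∀ᶠ t in 𝓝 (x, y), (m' : ℕ∞) ≤ t.1.length :=
    (continuous_fst.tendsto (x, y)).eventually (eventually_le_length h'.le_left)
  have hl2 : ∀ᶠ t in 𝓝 (x, y), (n' : ℕ∞) ≤ t.2.length :=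
    (continuous_snd.tendsto (x, y)).eventually (eventually_le_length h'.le_right)
  rcases le_total m m' with hm | hm
  · obtain ⟨d, rfl⟩ := Nat.exists_eq_add_of_le' hm
    obtain rfl : n' = d + n := by push_cast at hk; omega
    filter_upwards [hl1, hl2] with t h1 h2 ht
    refine ⟨h1, h2, ?_⟩
    rw [Function.iterate_add_apply, ht.eq, ← Function.iterate_add_apply]
  · obtain ⟨d, rfl⟩ := Nat.exists_eq_add_of_le' hm
    obtain rfl : n = d + n' := by push_cast at hk; omega
    have hd : (d : ℕ∞) ≤ (shift^[m'] x).length := by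
      have := h.le_left
      rw [← length_iterate_shift m' h'.le_left, Nat.cast_add] at this
      exact (ENat.add_le_add_iff_right (ENat.natCast_ne_top m')).1 this
    obtain ⟨e, hxe, he⟩ := isLocalHomeomorphOn_iterate_shift d _ hd
    have hx : ∀ᶠ t in 𝓝 (x, y), shift^[m'] t.1 ∈ e.source :=
      (continuous_fst.tendsto (x, y)).eventually ((continuousAt_iterate_shift h'.le_left).eventually
        (e.open_source.mem_nhds hxe))
    have hy : ∀ᶠ t in 𝓝 (x, y), shift^[n'] t.2 ∈ e.source :=
      (continuous_snd.tendsto (x, y)).eventually ((continuousAt_iterate_shift h'.le_right).eventually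
        (e.open_source.mem_nhds (h'.eq ▸ hxe)))
    filter_upwards [hl1, hl2, hx, hy] with t h1 h2 h3 h4 ht
    refine ⟨h1, h2, e.injOn h3 h4 ?_⟩
    rw [← he, ← Function.iterate_add_apply, ht.eq, Function.iterate_add_apply]

/-- Since `σ^n` has a local inverse at `y`, every point near `x` is related to a point near `y`. -/
theorem exists_section (h : ShiftRel m n x y) :
    ∃ τ : G.BoundaryPath → G.BoundaryPath, Tendsto τ (𝓝 x) (𝓝 y) ∧
      ∀ᶠ x' in 𝓝 x, ShiftRel m n x' (τ x') := by
  obtain ⟨e, hye, he⟩ := isLocalHomeomorphOn_iterate_shift n _ h.le_right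
  have hxy : shift^[m] x = e y := by rw [h.eq, he]
  have hc := continuousAt_iterate_shift h.le_left
  have hτ : Tendsto (fun x' => e.symm (shift^[m] x')) (𝓝 x) (𝓝 y) := by
    have h1 := e.continuousAt_symm (e.map_source hye)
    rw [ContinuousAt, e.left_inv hye, ← hxy] at h1
    exact h1.comp hc
  refine ⟨_, hτ, ?_⟩
  filter_upwards [eventually_le_length h.le_left, hτ.eventually (eventually_le_length h.le_right),
    hc.eventually (e.open_target.mem_nhds (hxy ▸ e.map_source hye))] with x' h1 h2 h3
  refine ⟨h1, h2, ?_⟩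
  rw [he, e.right_inv h3]

end ShiftRel

/-! ### Condition (L) -/

/-- The segment of length `d` of an infinite path, starting at position `t`, and its range. -/
theorem isPathFrom_map_range (e : ℕ → E) (h : ∀ i, G.r (e i) = G.s (e (i + 1))) (d : ℕ) :
    ∀ t, G.IsPathFrom (G.s (e t)) ((List.range d).map fun i => e (t + i)) ∧
      G.rangeFrom (G.s (e t)) ((List.range d).map fun i => e (t + i)) = G.s (e (t + d)) := by
  induction d with
  | zero => exact fun t => ⟨trivial, rfl⟩
  | succ d ih =>
    intro t
    have h1 : (List.range (d + 1)).map (fun i => e (t + i))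
        = e t :: (List.range d).map fun i => e (t + 1 + i) := by
      rw [List.range_succ_eq_map, List.map_cons, List.map_map]
      refine congrArg₂ _ rfl (List.map_congr_left fun i _ => ?_)
      simp only [Function.comp_apply]
      congr 1
      omega
    rw [h1]
    refine ⟨⟨rfl, h t ▸ (ih (t + 1)).1⟩, ?_⟩
    rw [rangeFrom, h t, (ih (t + 1)).2]
    congr 2
    omega

/-- Under Condition (L) no open set consists of eventually periodic paths with a common period:
following `x` up to an exit of its cycle that occurs late enough, and then leaving through that
exit, gives a path near `x` which is not periodic there. -/
theorem not_eventually_shiftRel_of_lt (hG : G.ConditionL) {p q : ℕ} {x : G.BoundaryPath}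
    (hpq : p < q) : ¬ ∀ᶠ z in 𝓝 x, ShiftRel p q z z := by
  intro h
  have hx := h.self_of_nhds
  obtain ⟨N, hN⟩ := exists_agree h
  match x, hx, hN with
  | finite μ hμ, hx, _ =>
    have h1 := length_iterate_shift p hx.le_left
    have h2 := length_iterate_shift q hx.le_right
    rw [hx.eq, ← h2] at h1
    have htop : (shift^[q] (finite μ hμ)).length ≠ ⊤ := fun htop => by
      rw [htop] at h2
      exact absurd h2 (by simp [length])
    exact hpq.ne (by exact_mod_cast (ENat.add_right_injective_of_ne_top htop) h1)
  | infinite e he, hx, hN =>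
    have hedge : ∀ i, e (i + p) = e (i + q) := fun i => by
      have := congrArg (fun z => edge z i) hx.eq
      simp only [edge_iterate_shift] at this
      exact Option.some.inj this
    obtain ⟨d, rfl⟩ := Nat.exists_eq_add_of_lt hpq
    -- One period, read off from a position `≥ N + q`: a path that leaves `x` there agrees with `x`
    -- on the first `N` edges and already has its periodic behaviour up to the exit.
    have hpath := isPathFrom_map_range e he (d + 1) (N + (p + d + 1))
    obtain ⟨e', he', f, hfs, hfe⟩ := hG ⟨_, _, hpath.1⟩ ⟨by simp, by
      have h1 : e (N + (p + d + 1)) = e (N + (p + d + 1) + (d + 1)) :=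
        (congrArg e (by omega)).trans ((hedge (N + d + 1)).trans (congrArg e (by omega)))
      exact (congrArg G.s h1).trans hpath.2.symm⟩
    obtain ⟨i, -, rfl⟩ := List.mem_map.1 he'
    obtain ⟨w, hw⟩ := exists_source_eq (G := G) (G.r f)
    obtain ⟨z, hz, -⟩ := exists_cons hw
    set j := N + (p + d + 1) + i with hj
    obtain ⟨y, hy, hys, hye⟩ := exists_replace_tail j (x := infinite e he) (z := z)
      (by simp [length]) (by
      rw [source_eq_of_edge hz, hfs]
      refine (source_eq_of_edge ?_).symm
      rw [edge_iterate_shift, Nat.zero_add]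
      rfl)
    have hrel := hN y hys fun i hi => hye i (by omega)
    have h1 : y.edge (N + i + p) = y.edge (N + i + (p + d + 1)) := by
      rw [← edge_iterate_shift, hrel.eq, edge_iterate_shift]
    have h2 : y.edge (N + i + (p + d + 1)) = some f := by
      have : N + i + (p + d + 1) = 0 + j := by omega
      rw [this, ← edge_iterate_shift, hy, hz]
    rw [h2, hye _ (by omega)] at h1
    have h3 : e (N + i + p) = f := by simpa [edge] using h1
    rw [hedge] at h3
    refine hfe (h3 ▸ ?_)
    congr 1
    omega

theorem eq_of_eventually_shiftRel (hG : G.ConditionL) {p q : ℕ} {x : G.BoundaryPath}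
    (h : ∀ᶠ z in 𝓝 x, ShiftRel p q z z) : p = q := by
  rcases lt_trichotomy p q with hpq | hpq | hpq
  · exact absurd h (not_eventually_shiftRel_of_lt hG hpq)
  · exact hpq
  · exact absurd (h.mono fun z hz => hz.symm) (not_eventually_shiftRel_of_lt hG hpq)

/-! ### Transport of germs -/

/-- The map `κ` carries the germ at `(x, k, y)` of the tail relation of lag `k` into the tail
relation of lag `k'`: for suitable exponents with `m - n = k` and `a - b = k'`, all pairs
`(x', y')` near `(x, y)` with `σ^m x' = σ^n y'` satisfy `σ^a (κ x') = σ^b (κ y')`. -/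
def MapsGerm (κ : G.BoundaryPath → H.BoundaryPath) (x y : G.BoundaryPath) (k k' : ℤ) : Prop :=
  ∃ m n a b : ℕ, k = m - n ∧ k' = a - b ∧ ShiftRel m n x y ∧
    ∀ᶠ t in 𝓝 (x, y), ShiftRel m n t.1 t.2 → ShiftRel a b (κ t.1) (κ t.2)

namespace MapsGerm

variable {κ : G.BoundaryPath → H.BoundaryPath} {x y z : G.BoundaryPath} {k k' j j' : ℤ}

theorem exists_shiftRel (h : MapsGerm κ x y k k') :
    ∃ a b : ℕ, k' = a - b ∧ ShiftRel a b (κ x) (κ y) := by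
  obtain ⟨m, n, a, b, -, hk', hr, hev⟩ := h
  exact ⟨a, b, hk', hev.self_of_nhds hr⟩

/-- The exponents in `MapsGerm` may be replaced by any others with the same differences. -/
theorem eventually_imp (hκ : Continuous κ) (h : MapsGerm κ x y k k') {m n a b : ℕ}
    (hk : k = m - n) (hr : ShiftRel m n x y) (hk' : k' = a - b)
    (hr' : ShiftRel a b (κ x) (κ y)) :
    ∀ᶠ t in 𝓝 (x, y), ShiftRel m n t.1 t.2 → ShiftRel a b (κ t.1) (κ t.2) := by
  obtain ⟨m₁, n₁, a₁, b₁, hk₁, hk₁', hr₁, hev⟩ := h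
  have hc : Tendsto (Prod.map κ κ) (𝓝 (x, y)) (𝓝 (κ x, κ y)) := (hκ.prodMap hκ).continuousAt
  filter_upwards [hev, hr.eventually_imp hr₁ (by omega), hc.eventually
    ((hev.self_of_nhds hr₁).eventually_imp hr' (by omega))] with t h1 h2 h3 ht
  exact h3 (h1 (h2 ht))

theorem refl (x : G.BoundaryPath) : MapsGerm κ x x 0 0 := by
  refine ⟨0, 0, 0, 0, by simp, by simp, .refl x, .of_forall fun t ht => ?_⟩
  have : t.1 = t.2 := ht.eq
  exact this ▸ .refl _

theorem inv (h : MapsGerm κ x y k k') : MapsGerm κ y x (-k) (-k') := by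
  obtain ⟨m, n, a, b, hk, hk', hr, hev⟩ := h
  refine ⟨n, m, b, a, by omega, by omega, hr.symm, ?_⟩
  filter_upwards [(continuous_swap.tendsto (y, x)).eventually hev] with t h1 ht
  exact (h1 ht.symm).symm

theorem mul (h : MapsGerm κ x y k k') (h' : MapsGerm κ y z j j') :
    MapsGerm κ x z (k + j) (k' + j') := by
  obtain ⟨m, n, a, b, hk, hk', hr, hev⟩ := h
  obtain ⟨m₁, n₁, a₁, b₁, hj, hj', hr₁, hev₁⟩ := h'
  refine ⟨_, _, a + (a₁ - b), b₁ + (b - a₁), ?_, by omega, hr.trans hr₁, ?_⟩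
  · push_cast
    omega
  -- A section through `y` interpolates a point between the ends of a pair near `(x, z)`.
  obtain ⟨τ, hτ, hτr⟩ := hr.exists_section
  have h1 : Tendsto (fun t : G.BoundaryPath × G.BoundaryPath => (t.1, τ t.1)) (𝓝 (x, z))
      (𝓝 (x, y)) := continuousAt_fst.prodMk_nhds (hτ.comp (continuous_fst.tendsto (x, z)))
  have h2 : Tendsto (fun t : G.BoundaryPath × G.BoundaryPath => (τ t.1, t.2)) (𝓝 (x, z))
      (𝓝 (y, z)) := (hτ.comp (continuous_fst.tendsto (x, z))).prodMk_nhds continuousAt_snd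
  filter_upwards [h1.eventually hev, h2.eventually hev₁,
    (continuous_fst.tendsto (x, z)).eventually hτr,
    h2.eventually ((hr.symm.trans (hr.trans hr₁)).eventually_imp hr₁ (by push_cast; omega))]
    with t h3 h4 h5 h6 ht
  exact (h3 h5).trans (h4 (h6 (h5.symm.trans ht)))

theorem comp {V'' E'' : Type*} {K : DirGraph V'' E''} {κ' : H.BoundaryPath → K.BoundaryPath}
    (hκ : Continuous κ) (h : MapsGerm κ x y k k') (h' : MapsGerm κ' (κ x) (κ y) k' j) :
    MapsGerm (κ' ∘ κ) x y k j := by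
  obtain ⟨m, n, -, -, hk, -, hr, -⟩ := id h
  obtain ⟨a, b, c, d, hk', hj, hr', hev'⟩ := h'
  have hc : Tendsto (Prod.map κ κ) (𝓝 (x, y)) (𝓝 (κ x, κ y)) := (hκ.prodMap hκ).continuousAt
  refine ⟨m, n, c, d, hk, hj, hr, ?_⟩
  filter_upwards [h.eventually_imp hκ hk hr hk' hr', hc.eventually hev'] with t h1 h2 ht
  exact h2 (h1 ht)

/-- Condition (L) makes the lag `k'` of the image germ unique: if `κ y'` were related to `κ x'`
with two different lags for all related `x'`, `y'` near `x`, `y`, then all paths near `κ x` would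
be eventually periodic. -/
theorem unique {κ : G.BoundaryPath ≃ₜ H.BoundaryPath} (hH : H.ConditionL)
    (h : MapsGerm κ x y k k') (h' : MapsGerm κ x y k j') : k' = j' := by
  obtain ⟨m, n, a, b, hk, hk', hr, hev⟩ := h
  obtain ⟨m₁, n₁, a₁, b₁, hk₁, hk₁', hr₁, hev₁⟩ := h'
  obtain ⟨τ, hτ, hτr⟩ := hr.exists_section
  have hc : Tendsto (fun x' => (x', τ x')) (𝓝 x) (𝓝 (x, y)) := tendsto_id.prodMk_nhds hτ
  have hloop : ∀ᶠ z in 𝓝 (κ x), ShiftRel (a + (b₁ - b)) (a₁ + (b - b₁)) z z := by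
    rw [← κ.map_nhds_eq, eventually_map]
    filter_upwards [hτr, hc.eventually hev, hc.eventually hev₁,
      hc.eventually (hr.eventually_imp hr₁ (by omega))] with x' h1 h2 h3 h4
    exact (h2 h1).trans (h3 (h4 h1)).symm
  have := eq_of_eventually_shiftRel hH hloop
  omega

/-- The cocycles of an orbit equivalence say that the germ of the shift is carried to a germ. -/
theorem of_hasOrbitCocycles (hκ : HasOrbitCocycles κ) (hx : 1 ≤ x.length) :
    ∃ c, MapsGerm κ x x.shift 1 c := by
  obtain ⟨l, m, hl, hm, h⟩ := hκ
  refine ⟨_, 1, 0, l ⟨x, hx⟩, m ⟨x, hx⟩, by simp, rfl, ⟨by simpa using hx, by simp, rfl⟩, ?_⟩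
  have hopen : ∀ᶠ x' in 𝓝 x, 1 ≤ x'.length := by
    have := eventually_le_length (n := 1) (by exact_mod_cast hx)
    exact_mod_cast this
  have hlm : ∀ᶠ x' in 𝓝 x, ∃ h' : 1 ≤ x'.length,
      l ⟨x', h'⟩ = l ⟨x, hx⟩ ∧ m ⟨x', h'⟩ = m ⟨x, hx⟩ := by
    rw [← map_nhds_subtype_coe_eq_nhds (p := fun x' : G.BoundaryPath => 1 ≤ x'.length) hx hopen,
      eventually_map]
    filter_upwards [hl.continuousAt.eventually (isOpen_discrete {l ⟨x, hx⟩} |>.mem_nhds rfl),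
      hm.continuousAt.eventually (isOpen_discrete {m ⟨x, hx⟩} |>.mem_nhds rfl)] with t h1 h2
    exact ⟨t.2, h1, h2⟩
  filter_upwards [(continuous_fst.tendsto (x, x.shift)).eventually hlm] with t ⟨h1, h2, h3⟩ ht
  have hs : shift t.1 = t.2 := ht.eq
  obtain ⟨h4, h5, h6⟩ := h ⟨t.1, h1⟩
  rw [h2, h3] at *
  exact ⟨h5, hs ▸ h4, hs ▸ h6.symm⟩

theorem of_hasOrbitCocycles_iterate (hκ : HasOrbitCocycles κ) (m : ℕ) :
    ∀ {x : G.BoundaryPath}, (m : ℕ∞) ≤ x.length → ∃ c, MapsGerm κ x (shift^[m] x) m c := by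
  induction m with
  | zero => exact fun {x} _ => ⟨0, .refl x⟩
  | succ m ih =>
    intro x hx
    obtain ⟨c, hc⟩ := of_hasOrbitCocycles hκ (le_trans (by simp) hx)
    obtain ⟨c', hc'⟩ := ih (le_length_shift hx)
    refine ⟨c + c', ?_⟩
    have := hc.mul hc'
    rwa [add_comm (1 : ℤ)] at this

/-- Every groupoid element is a product `(x, m, σ^m x)(σ^n y, -n, y)` of iterated shifts and
their inverses, so an orbit equivalence carries its germ to a germ. -/
theorem exists_of_hasOrbitCocycles (hκ : HasOrbitCocycles κ) (g : G.GraphGroupoid) :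
    ∃ k', MapsGerm κ g.range g.source g.lag k' := by
  obtain ⟨m, n, hk, hm, hn, hs⟩ := g.mem
  obtain ⟨c, hc⟩ := of_hasOrbitCocycles_iterate hκ m hm
  obtain ⟨d, hd⟩ := of_hasOrbitCocycles_iterate hκ n hn
  rw [hs] at hc
  exact ⟨_, by rw [hk, sub_eq_add_neg]; exact hc.mul hd.inv⟩

end MapsGerm

end BoundaryPath

namespace GraphGroupoid

open BoundaryPath

/-! ### The induced isomorphism of groupoids -/

theorem exists_shiftRel (g : G.GraphGroupoid) :
    ∃ m n : ℕ, g.lag = m - n ∧ ShiftRel m n g.range g.source := by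
  obtain ⟨m, n, hk, hm, hn, hs⟩ := g.mem
  exact ⟨m, n, hk, hm, hn, hs⟩

/-- Groupoid elements near `g` have the same lag, with the same exponents, and ends near those
of `g`. -/
theorem eventually_nhds {g : G.GraphGroupoid} {m n : ℕ} (hk : g.lag = m - n)
    (hr : ShiftRel m n g.range g.source) {P : G.BoundaryPath × G.BoundaryPath → Prop}
    (hP : ∀ᶠ t in 𝓝 (g.range, g.source), P t) :
    ∀ᶠ g' in 𝓝 g, g'.lag = (m : ℤ) - n ∧ ShiftRel m n g'.range g'.source ∧
      P (g'.range, g'.source) := by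
  obtain ⟨e, hxe, he⟩ := isLocalHomeomorphOn_iterate_shift m _ hr.le_left
  obtain ⟨f, hyf, hf⟩ := isLocalHomeomorphOn_iterate_shift n _ hr.le_right
  rw [nhds_prod_eq, eventually_prod_iff] at hP
  obtain ⟨p, hp, q, hq, hpq⟩ := hP
  obtain ⟨U, hU, hUo, hxU⟩ := eventually_nhds_iff.1
    ((hp.and (eventually_le_length hr.le_left)).and (e.open_source.mem_nhds hxe))
  obtain ⟨W, hW, hWo, hyW⟩ := eventually_nhds_iff.1
    ((hq.and (eventually_le_length hr.le_right)).and (f.open_source.mem_nhds hyf))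
  -- The sets `U` and `W` are cut down to the preimages of `O`, which makes their images agree.
  set O : Set G.BoundaryPath := shift^[m] '' U ∩ shift^[n] '' W with hO
  have hOo : IsOpen O := by
    rw [hO, he, hf]
    exact (e.isOpen_image_of_subset_source hUo fun x hx => (hU x hx).2).inter
      (f.isOpen_image_of_subset_source hWo fun x hx => (hW x hx).2)
  have hopen : IsOpen (basicSet (U ∩ shift^[m] ⁻¹' O) m n (W ∩ shift^[n] ⁻¹' O)) := by
    refine TopologicalSpace.isOpen_generateFrom_of_mem ⟨m, n, _, _, ?_, fun x hx =>
      (hU x hx.1).1.2, ?_, ?_, fun x hx => (hW x hx.1).1.2, ?_, ?_, rfl⟩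
    · rw [← Set.inter_eq_left.2 (fun x hx => (hU x hx).2 : U ⊆ e.source), Set.inter_assoc, he]
      exact hUo.inter (e.isOpen_inter_preimage hOo)
    · rw [he]
      exact e.injOn.mono fun x hx => (hU x hx.1).2
    · rw [← Set.inter_eq_left.2 (fun x hx => (hW x hx).2 : W ⊆ f.source), Set.inter_assoc, hf]
      exact hWo.inter (f.isOpen_inter_preimage hOo)
    · rw [hf]
      exact f.injOn.mono fun x hx => (hW x hx.1).2
    · rw [Set.image_inter_preimage, Set.image_inter_preimage, hO]
      ext x
      simp only [Set.mem_inter_iff]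
      tauto
  have hmem : g ∈ basicSet (U ∩ shift^[m] ⁻¹' O) m n (W ∩ shift^[n] ⁻¹' O) := by
    refine ⟨⟨hxU, ⟨_, hxU, rfl⟩, ⟨_, hyW, hr.eq.symm⟩⟩, hk, ⟨hyW, ⟨_, hxU, hr.eq⟩, ⟨_, hyW, rfl⟩⟩,
      hr.eq⟩
  filter_upwards [hopen.mem_nhds hmem] with g' hg'
  obtain ⟨⟨h1, -⟩, h2, ⟨h3, -⟩, h4⟩ := hg'
  exact ⟨h2, ⟨(hU _ h1).1.2, (hW _ h3).1.2, h4⟩, hpq (hU _ h1).1.1 (hW _ h3).1.1⟩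

/-- The map `(x, k, y) ↦ (κ x, k', κ y)`, where `k'` is a lag to which `κ` carries the germ at
`(x, k, y)`. -/
noncomputable def mapOfGerms (κ : G.BoundaryPath → H.BoundaryPath) (hκ : HasOrbitCocycles κ)
    (g : G.GraphGroupoid) : H.GraphGroupoid where
  range := κ g.range
  lag := (MapsGerm.exists_of_hasOrbitCocycles hκ g).choose
  source := κ g.source
  mem := by
    obtain ⟨a, b, hk, h⟩ :=
      (MapsGerm.exists_of_hasOrbitCocycles hκ g).choose_spec.exists_shiftRel
    exact ⟨a, b, hk, h.le_left, h.le_right, h.eq⟩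

theorem mapsGerm_mapOfGerms {κ : G.BoundaryPath → H.BoundaryPath} (hκ : HasOrbitCocycles κ)
    (g : G.GraphGroupoid) :
    MapsGerm κ g.range g.source g.lag (mapOfGerms κ hκ g).lag :=
  (MapsGerm.exists_of_hasOrbitCocycles hκ g).choose_spec

variable {κ : G.BoundaryPath ≃ₜ H.BoundaryPath}

theorem mapOfGerms_eq (hH : H.ConditionL) (hκ : HasOrbitCocycles κ) {g : G.GraphGroupoid}
    {g' : H.GraphGroupoid} (hr : g'.range = κ g.range) (hs : g'.source = κ g.source)
    (h : MapsGerm κ g.range g.source g.lag g'.lag) : mapOfGerms κ hκ g = g' :=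
  GraphGroupoid.ext hr.symm ((mapsGerm_mapOfGerms hκ g).unique hH h) hs.symm

theorem continuous_mapOfGerms (hH : H.ConditionL) (hκ : HasOrbitCocycles κ) :
    Continuous (mapOfGerms κ hκ) := by
  refine continuous_iff_continuousAt.2 fun g =>
    TopologicalSpace.tendsto_nhds_generateFrom_iff.2 ?_
  rintro _ ⟨a, b, U, W, hU, hUa, -, hW, hWb, -, -, rfl⟩ ⟨hgU, hk', hgW, hs⟩
  obtain ⟨m, n, hk, hr⟩ := g.exists_shiftRel
  have hr' : ShiftRel a b (κ g.range) (κ g.source) := ⟨hUa _ hgU, hWb _ hgW, hs⟩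
  have hev := (mapsGerm_mapOfGerms hκ g).eventually_imp κ.continuous hk hr hk' hr'
  have hevU : ∀ᶠ t in 𝓝 (g.range, g.source), κ t.1 ∈ U :=
    (continuous_fst.tendsto (g.range, g.source)).eventually (κ.continuous.continuousAt (x := g.range)
      |>.eventually (hU.mem_nhds hgU))
  have hevW : ∀ᶠ t in 𝓝 (g.range, g.source), κ t.2 ∈ W :=
    (continuous_snd.tendsto (g.range, g.source)).eventually (κ.continuous.continuousAt (x := g.source)
      |>.eventually (hW.mem_nhds hgW))
  filter_upwards [eventually_nhds hk hr (hev.eventually_nhds.and (hevU.and hevW))] with g' hg'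
  obtain ⟨h1, h2, h3, h4, h5⟩ := hg'
  refine ⟨h4, ?_, h5, (h3.self_of_nhds h2).eq⟩
  exact (mapsGerm_mapOfGerms hκ g').unique hH ⟨m, n, a, b, h1, rfl, h2, h3⟩

theorem mapOfGerms_leftInverse (hG : G.ConditionL) (hκ : HasOrbitCocycles κ)
    (hκ' : HasOrbitCocycles κ.symm) :
    Function.LeftInverse (mapOfGerms κ.symm hκ') (mapOfGerms κ hκ) := by
  intro g
  have h := (mapsGerm_mapOfGerms hκ g).comp κ.continuous
    (mapsGerm_mapOfGerms hκ' (mapOfGerms κ hκ g))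
  have hid : κ.symm ∘ κ = Homeomorph.refl G.BoundaryPath := funext κ.symm_apply_apply
  rw [hid] at h
  obtain ⟨m, n, hk, hr⟩ := g.exists_shiftRel
  have hg : MapsGerm (Homeomorph.refl G.BoundaryPath) g.range g.source g.lag g.lag :=
    ⟨m, n, m, n, hk, hk, hr, .of_forall fun _ ht => ht⟩
  exact GraphGroupoid.ext (κ.symm_apply_apply _) (h.unique hG hg) (κ.symm_apply_apply _)

/-- The isomorphism of topological groupoids induced by an orbit equivalence. -/
noncomputable def isoOfOrbitEquivalence (hG : G.ConditionL) (hH : H.ConditionL)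
    (hκ : IsOrbitEquivalence κ) : Iso G H where
  toHomeomorph :=
    { toFun := mapOfGerms κ hκ.1
      invFun := mapOfGerms κ.symm hκ.2
      left_inv := mapOfGerms_leftInverse hG hκ.1 hκ.2
      right_inv := mapOfGerms_leftInverse (κ := κ.symm) hH hκ.2 hκ.1
      continuous_toFun := continuous_mapOfGerms hH hκ.1
      continuous_invFun := continuous_mapOfGerms hG hκ.2 }
  composable_iff _ _ := κ.injective.eq_iff.symm
  map_mul g h hgh := by
    refine mapOfGerms_eq hH hκ.1 rfl rfl ?_
    have h1 := mapsGerm_mapOfGerms hκ.1 g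
    rw [hgh] at h1
    exact h1.mul (mapsGerm_mapOfGerms hκ.1 h)
  map_inv g := mapOfGerms_eq hH hκ.1 rfl rfl (mapsGerm_mapOfGerms hκ.1 g).inv

end GraphGroupoid

end DirGraph

theorem theorem3p6 {V : Type*} {E : Type*} {V' : Type*} {E' : Type*}
    [Countable V] [Countable E] [Countable V'] [Countable E']
    (G : DirGraph V E) (H : DirGraph V' E') (hG : G.ConditionL) (hH : H.ConditionL)
    (κ : G.BoundaryPath ≃ₜ H.BoundaryPath) (hκ : DirGraph.IsOrbitEquivalence κ) :
    ∃ φ : DirGraph.GraphGroupoid.Iso G H, ∀ x : G.BoundaryPath,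
      φ.toHomeomorph (DirGraph.GraphGroupoid.unit x) = DirGraph.GraphGroupoid.unit (κ x) :=
  ⟨DirGraph.GraphGroupoid.isoOfOrbitEquivalence hG hH hκ, fun x =>
    DirGraph.GraphGroupoid.mapOfGerms_eq hH hκ.1 rfl rfl (.refl x)⟩
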